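/- For a finite partially ordered set $X$ let $w(X)$ denote its width, the maximum size of an antichain in $X$. A chain $c$ in $X$ is skipless if, whenever $y$ covers $x$ in $c$, $y$ covers $x$ in $X$. An SD-partition of $X$ is a partition of $X$ into exactly $w(X)$ skipless chains. Let $\mathcal D$ be a downset in the Boolean lattice $\mathcal B(n)$ of subsets of $[n]$ (a family of sets closed under taking subsets), and let $\mathbf C$ be an SD-partition of $\mathcal D$. Let $Y\in\mathcal B(n)\setminus\mathcal D$ with $|Y|=k$ be such that $\mathcal D'=\mathcal D\cup\{Y\}$ is also a downset. Let $\mathcal G_k$ be the bipartite graph whose parts are the $(k-1)$-sets in $\mathcal D'$ and the $k$-sets in $\mathcal D'$, in which a $(k-1)$-set is adjacent to a $k$-set if it is contained in it. Let $\mathbf M$ be the matching in $\mathcal G_k$ consisting of the edges whose two ends lie in the same chain of $\mathbf C$. A path $Y, X_1, Y_1, X_2, Y_2, \ldots, X_r, Y_r, X_{r+1}$ in $\mathcal G_k$ (with distinct vertices, $r\ge 0$) is called augmenting if $\{X_i,Y_i\}\in\mathbf M$ for $i=1,\ldots,r$ and $X_{r+1}$ is the maximum element of its chain in $\mathbf C$.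 Then $w(\mathcal D)=w(\mathcal D')$ if and only if there is an augmenting path in $\mathcal G_k$. -/

import Mathlib

/-- The width of a finite subset `X` of a partially ordered set: the maximum size of an antichain
contained in `X`. -/
noncomputable def width {α : Type*} [PartialOrder α] (X : Finset α) : ℕ := by
  classical
  exact (X.powerset.filter fun A : Finset α => IsAntichain (· ≤ ·) (A : Set α)).sup Finset.card

/-- `y` covers `x` in the subposet `S`. -/
def CoversIn {α : Type*} [PartialOrder α] (S : Finset α) (x y : α) : Prop :=
  x ∈ S ∧ y ∈ S ∧ x < y ∧ ∀ z ∈ S, x ≤ z → z ≤ y → z = x ∨ z = y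

/-- A skipless chain `c` of `X`: a chain contained in `X` in which every covering pair of `c` is a
covering pair of `X`. -/
def IsSkiplessChain {α : Type*} [PartialOrder α] (X c : Finset α) : Prop :=
  c ⊆ X ∧ IsChain (· ≤ ·) (c : Set α) ∧ ∀ x y, CoversIn c x y → CoversIn X x y

/-- An SD-partition of `X`: a partition of `X` into exactly `width X` (nonempty) skipless chains. -/
def IsSDPartition {α : Type*} [PartialOrder α] [DecidableEq α] {X : Finset α}
    (C : Finpartition X) : Prop :=
  (∀ c ∈ C.parts, IsSkiplessChain X c) ∧ C.parts.card = width X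

/-- The bipartite graph induced by a family `F` on levels `k - 1` and `k`: a `(k - 1)`-set and a
`k`-set of `F` are adjacent when the first is contained in the second. (It has no edges if
`k = 0`; sets outside the two parts are isolated.) -/
def levelGraph {n : ℕ} (F : Finset (Finset (Fin n))) (k : ℕ) : SimpleGraph (Finset (Fin n)) where
  Adj A B := A ∈ F ∧ B ∈ F ∧
    ((A.card + 1 = k ∧ B.card = k ∧ A ⊂ B) ∨ (B.card + 1 = k ∧ A.card = k ∧ B ⊂ A))
  symm := ⟨fun _ _ h => ⟨h.2.1, h.1, h.2.2.symm⟩⟩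
  loopless := ⟨fun A h => by
    rcases h.2.2 with h | h
    · exact (ssubset_irrefl A) h.2.2
    · exact (ssubset_irrefl A) h.2.2⟩

/-- The matching formed by the edges of `G` whose two ends belong to the same chain of `C`. -/
def chainMatching {α : Type*} [DecidableEq α] {X : Finset α} (C : Finpartition X)
    (G : SimpleGraph α) : SimpleGraph α where
  Adj a b := G.Adj a b ∧ ∃ c ∈ C.parts, a ∈ c ∧ b ∈ c
  symm := ⟨fun _ _ h => ⟨h.1.symm, h.2.imp fun _ hc => ⟨hc.1, hc.2.2, hc.2.1⟩⟩⟩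
  loopless := ⟨fun _ h => h.1.ne rfl⟩

/-- A walk `Y = v₀, v₁, …, v_m = Z` in `G` is an augmenting path (with respect to the chain
partition `C`) if its vertices are distinct, `m = 2 r + 1` is odd, each edge `v_{2i+1} v_{2i+2}`
belongs to the matching given by `C`, and `Z` is the maximum of its chain in `C`. -/
def IsAugmentingPath {α : Type*} [PartialOrder α] [DecidableEq α] {X : Finset α}
    (C : Finpartition X) {G : SimpleGraph α} {Y Z : α} (p : G.Walk Y Z) : Prop :=
  p.IsPath ∧ Odd p.length ∧
    (∀ i : ℕ, 2 * i + 2 ≤ p.length →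
      (chainMatching C G).Adj (p.getVert (2 * i + 1)) (p.getVert (2 * i + 2))) ∧
    ∃ c ∈ C.parts, IsGreatest (c : Set α) Z

/-! Adding one set never lowers the width, so the issue is whether it rises.

If an augmenting path exists, switching tails of chains along it, starting from its far end, frees a
chain on top of which `Y` can be placed. Then `insert Y D` is covered by `width D` chains, and its
width cannot exceed that number (`IsChainColoring.exists_insert`).

If there is none, let `A` be the `(k - 1)`-sets reached from `Y` by alternating paths. No member of
`A` is the maximum of its chain, so skiplessness matches it to a `k`-set. Let `B` consist of `Y` and
these partners. Alternating paths extend through partners, so every facet of a member of `B` lies in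
`A`, while the matching embeds `A` in `B` and misses `Y`. A maximum antichain `T` of `D` can now be
enlarged. If nothing in `T` lies below `Y`, add `Y`. Otherwise replace the members of `T` lying
strictly below sets of `B` by the sets of `B` strictly above them (`exists_isAntichain_card_lt`).

That this replacement loses nothing is a Hall-type statement on all levels of the downset generated
by `B`. The matching of the top two levels is a fractional matching, and averaging it over
one-element extensions carries it down one level at a time (`IsLevelFlow.descend`). The surplus set
`Y` then makes the new antichain strictly larger. -/

/-! ### Fractional matchings between consecutive levels of a downset. -/

section LevelFlow

variable {α : Type*} [Fintype α] [DecidableEq α]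

/-- A fractional matching from the sets of size `j` to the sets of size `j + 1` of a family `P`
that saturates the former; `F s x` is the weight of the pair `s ⊂ insert x s`. -/
structure IsLevelFlow (P : Finset (Finset α)) (j : ℕ) (F : Finset α → α → ℚ) : Prop where
  nonneg : ∀ s x, 0 ≤ F s x
  notMem : ∀ s x, F s x ≠ 0 → x ∉ s
  insert_mem : ∀ s x, F s x ≠ 0 → insert x s ∈ P
  out_eq : ∀ s ∈ P, s.card = j → ∑ x, F s x = 1
  in_le : ∀ t ∈ P, t.card = j + 1 → ∑ x ∈ t, F (t.erase x) x ≤ 1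

/-- The number of one-element extensions of `s` in the family `P`. -/
def upDegree (P : Finset (Finset α)) (s : Finset α) : ℕ :=
  (sᶜ.filter fun y => insert y s ∈ P).card

/-- Whatever extends `t` also extends `t.erase x`, and `x` is one extension more. This monotonicity
keeps the averaged weights within capacity in `IsLevelFlow.descend`. -/
lemma upDegree_succ_le {P : Finset (Finset α)} (hP : IsLowerSet (P : Set (Finset α)))
    {t : Finset α} (ht : t ∈ P) {x : α} (hx : x ∈ t) :
    upDegree P t + 1 ≤ upDegree P (t.erase x) := by
  have hx' : x ∉ tᶜ.filter fun y => insert y t ∈ P := by simp [hx]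
  rw [upDegree, upDegree, ← Finset.card_insert_of_notMem hx']
  refine Finset.card_le_card fun y hy => ?_
  rcases Finset.mem_insert.1 hy with rfl | hy
  · simp [Finset.insert_erase hx, ht]
  · simp only [Finset.mem_filter, Finset.mem_compl, Finset.mem_erase, not_and] at hy ⊢
    exact ⟨fun _ => hy.1, hP (Finset.insert_subset_insert _ (Finset.erase_subset _ _)) hy.2⟩

/-- In a downset, a fractional matching saturating level `j + 1` induces one saturating
level `j`. -/
lemma IsLevelFlow.descend {P : Finset (Finset α)} (hP : IsLowerSet (P : Set (Finset α))) {j : ℕ}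
    (hpure : ∀ s ∈ P, s.card = j → ∃ y ∉ s, insert y s ∈ P)
    {F : Finset α → α → ℚ} (hF : IsLevelFlow P (j + 1) F) :
    IsLevelFlow P j fun s x => (∑ y ∈ sᶜ, F (insert y s) x) / upDegree P s := by
  have key : ∀ s x, (∑ y ∈ sᶜ, F (insert y s) x) / (upDegree P s : ℚ) ≠ 0 →
      ∃ y ∉ s, F (insert y s) x ≠ 0 := by
    intro s x h
    by_contra! h'
    refine h ?_
    rw [Finset.sum_eq_zero fun y hy => h' y (Finset.mem_compl.1 hy), zero_div]
  refine ⟨fun s x => ?_, fun s x h => ?_, fun s x h => ?_, fun s hs hj => ?_, fun t ht hj => ?_⟩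
  · exact div_nonneg (Finset.sum_nonneg fun _ _ => hF.nonneg _ _) (Nat.cast_nonneg _)
  · obtain ⟨y, -, hy⟩ := key s x h
    exact fun hx => hF.notMem _ _ hy (Finset.mem_insert_of_mem hx)
  · obtain ⟨y, -, hy⟩ := key s x h
    exact hP (Finset.insert_subset_insert _ (Finset.subset_insert _ _)) (hF.insert_mem _ _ hy)
  · have hd : (upDegree P s : ℚ) ≠ 0 := by
      obtain ⟨y, hy, hyP⟩ := hpure s hs hj
      have : y ∈ sᶜ.filter fun y => insert y s ∈ P := by simp [hy, hyP]
      exact_mod_cast (Finset.card_pos.2 ⟨y, this⟩).ne'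
    rw [← Finset.sum_div, Finset.sum_comm, div_eq_one_iff_eq hd, upDegree, Finset.card_filter,
      Nat.cast_sum]
    refine Finset.sum_congr rfl fun y hy => ?_
    split_ifs with h
    · rw [hF.out_eq _ h (by rw [Finset.card_insert_of_notMem (Finset.mem_compl.1 hy), hj])]
      simp
    · rw [Nat.cast_zero]
      refine Finset.sum_eq_zero fun x _ => ?_
      by_contra hx
      exact h (hP (Finset.subset_insert _ _) (hF.insert_mem _ _ hx))
  · have hpos : (0 : ℚ) < upDegree P t + 1 := by positivity
    have h1 : ∀ x ∈ t, (∑ y ∈ (t.erase x)ᶜ, F (insert y (t.erase x)) x) /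
        (upDegree P (t.erase x) : ℚ) ≤
        (∑ y ∈ tᶜ, F ((insert y t).erase x) x) / (upDegree P t + 1) := by
      intro x hx
      have hsum : ∑ y ∈ (t.erase x)ᶜ, F (insert y (t.erase x)) x =
          ∑ y ∈ tᶜ, F ((insert y t).erase x) x := by
        rw [Finset.compl_erase, Finset.sum_insert (by simp [hx]), Finset.insert_erase hx]
        have h0 : F t x = 0 := by
          by_contra h
          exact hF.notMem _ _ h hx
        rw [h0, zero_add]
        refine Finset.sum_congr rfl fun y hy => ?_
        have hne : y ≠ x := fun h => Finset.mem_compl.1 hy (h ▸ hx)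
        rw [Finset.erase_insert_of_ne hne]
      rw [hsum]
      exact div_le_div_of_nonneg_left (Finset.sum_nonneg fun _ _ => hF.nonneg _ _) hpos
        (by exact_mod_cast upDegree_succ_le hP ht hx)
    refine (Finset.sum_le_sum h1).trans ?_
    rw [← Finset.sum_div, Finset.sum_comm, div_le_one hpos]
    refine le_trans ?_ (le_add_of_nonneg_right zero_le_one)
    rw [upDegree, Finset.card_filter, Nat.cast_sum]
    refine Finset.sum_le_sum fun y hy => ?_
    have hyt := Finset.mem_compl.1 hy
    split_ifs with h
    · rw [Nat.cast_one]
      refine le_trans ?_ (hF.in_le _ h (by rw [Finset.card_insert_of_notMem hyt, hj]))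
      exact Finset.sum_le_sum_of_subset_of_nonneg (Finset.subset_insert _ _)
        fun _ _ _ => hF.nonneg _ _
    · rw [Nat.cast_zero]
      refine (Finset.sum_eq_zero fun x hx => ?_).le
      by_contra hne
      have := hF.insert_mem _ _ hne
      rw [Finset.insert_erase (Finset.mem_insert_of_mem hx)] at this
      exact h this

/-- Hall's condition for a saturating fractional matching. -/
lemma IsLevelFlow.card_le {P : Finset (Finset α)} {j : ℕ} {F : Finset α → α → ℚ}
    (hF : IsLevelFlow P j F) {U N : Finset (Finset α)} (hU : ∀ s ∈ U, s ∈ P ∧ s.card = j)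
    (hN : ∀ t ∈ N, t ∈ P ∧ t.card = j + 1)
    (hUN : ∀ s ∈ U, ∀ x ∉ s, insert x s ∈ P → insert x s ∈ N) : U.card ≤ N.card := by
  have h1 : (U.card : ℚ) = ∑ s ∈ U, ∑ x, F s x := by
    rw [Finset.sum_congr rfl fun s hs => hF.out_eq s (hU s hs).1 (hU s hs).2]
    simp
  have h2 : ∑ t ∈ N, ∑ x ∈ t, F (t.erase x) x ≤ (N.card : ℚ) := by
    refine (Finset.sum_le_sum fun t ht => hF.in_le t (hN t ht).1 (hN t ht).2).trans ?_
    simp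
  have h3 : ∑ s ∈ U, ∑ x, F s x ≤ ∑ t ∈ N, ∑ x ∈ t, F (t.erase x) x := by
    rw [← Finset.sum_product', Finset.sum_sigma',
      ← Finset.sum_filter_ne_zero (s := U ×ˢ Finset.univ)]
    have hmem : ∀ q ∈ (U ×ˢ (Finset.univ : Finset α)).filter (fun q => F q.1 q.2 ≠ 0),
        q.1 ∈ U ∧ F q.1 q.2 ≠ 0 := fun q hq => by simpa using hq
    -- Double counting of weighted edges: an edge is indexed by its lower end or by its upper end.
    -- On the support `x ∉ s`, so erasing `x` recovers `s`.
    let g : Finset α × α → (_ : Finset α) × α := fun q => ⟨insert q.2 q.1, q.2⟩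
    have hgF : ∀ q ∈ (U ×ˢ (Finset.univ : Finset α)).filter (fun q => F q.1 q.2 ≠ 0),
        (g q).1.erase (g q).2 = q.1 := fun q hq =>
      Finset.erase_insert (hF.notMem _ _ (hmem q hq).2)
    have hinj : Set.InjOn g ((U ×ˢ (Finset.univ : Finset α)).filter
        (fun q => F q.1 q.2 ≠ 0) : Finset (Finset α × α)) := fun q hq q' hq' h => by
      refine Prod.ext ?_ (congrArg (fun p => p.2) h)
      rw [← hgF q hq, ← hgF q' hq', h]
    rw [Finset.sum_congr rfl fun q hq => show F q.1 q.2 = F ((g q).1.erase (g q).2) (g q).2 by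
        rw [hgF q hq], ← Finset.sum_image (f := fun p => F (p.1.erase p.2) p.2) hinj]
    refine Finset.sum_le_sum_of_subset_of_nonneg (fun p hp => ?_) fun _ _ _ => hF.nonneg _ _
    obtain ⟨q, hq, rfl⟩ := Finset.mem_image.1 hp
    obtain ⟨hqU, hq0⟩ := hmem q hq
    exact Finset.mem_sigma.2 ⟨hUN _ hqU _ (hF.notMem _ _ hq0) (hF.insert_mem _ _ hq0),
      Finset.mem_insert_self _ _⟩
  exact_mod_cast h1 ▸ h3.trans h2

/-- In a downset whose elements of size at most `m` all extend, a fractional matching saturating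
level `m` induces one saturating every lower level. -/
lemma IsLevelFlow.exists_of_le {P : Finset (Finset α)} (hP : IsLowerSet (P : Set (Finset α)))
    {m : ℕ} (hpure : ∀ s ∈ P, s.card ≤ m → ∃ y ∉ s, insert y s ∈ P)
    {F : Finset α → α → ℚ} (hF : IsLevelFlow P m F) {j : ℕ} (hj : j ≤ m) :
    ∃ F', IsLevelFlow P j F' := by
  induction hj using Nat.decreasingInduction with
  | self => exact ⟨F, hF⟩
  | of_succ i hi ih =>
    obtain ⟨F', hF'⟩ := ih
    exact ⟨_, hF'.descend hP fun s hs hc => hpure s hs (hc.le.trans hi.le)⟩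

/-- If all levels of `P` below `m` are saturated, then an antichain of elements of size at most `m`
lies below at least as many elements of size `m`. -/
lemma card_le_card_above_of_isLevelFlow {P S : Finset (Finset α)}
    (hS : IsAntichain (· ≤ ·) (S : Set (Finset α))) (hSP : S ⊆ P) (m : ℕ)
    (hflow : ∀ j < m, ∃ F, IsLevelFlow P j F) :
    (S.filter fun s => s.card ≤ m).card ≤
      (P.filter fun t => t.card = m ∧ ∃ s ∈ S, s ⊆ t).card := by
  induction m with
  | zero =>
    refine Finset.card_le_card fun s hs => ?_
    rw [Finset.mem_filter] at hs ⊢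
    exact ⟨hSP hs.1, Nat.le_zero.1 hs.2, s, hs.1, subset_rfl⟩
  | succ j ih =>
    obtain ⟨F, hF⟩ := hflow j j.lt_succ_self
    have h1 := ih fun i hi => hflow i (hi.trans j.lt_succ_self)
    have h2 := hF.card_le (U := P.filter fun t => t.card = j ∧ ∃ s ∈ S, s ⊆ t)
      (N := P.filter fun t => t.card = j + 1 ∧ ∃ s ∈ S, s ⊂ t)
      (fun s hs => by simp only [Finset.mem_filter] at hs; exact ⟨hs.1, hs.2.1⟩)
      (fun s hs => by simp only [Finset.mem_filter] at hs; exact ⟨hs.1, hs.2.1⟩)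
      (fun t ht x hx hxP => by
        simp only [Finset.mem_filter] at ht ⊢
        obtain ⟨-, htj, s, hs, hst⟩ := ht
        exact ⟨hxP, by rw [Finset.card_insert_of_notMem hx, htj], s, hs,
          hst.trans_ssubset (Finset.ssubset_insert hx)⟩)
    -- The sets pushed up from level `j` lie strictly above members of `S`, so they cannot collide
    -- with the members of `S` that join at level `j + 1`.
    have hdisj : Disjoint (P.filter fun t => t.card = j + 1 ∧ ∃ s ∈ S, s ⊂ t)
        (S.filter fun s => s.card = j + 1) := by
      refine Finset.disjoint_left.2 fun t ht ht' => ?_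
      simp only [Finset.mem_filter] at ht ht'
      obtain ⟨-, -, s, hs, hst⟩ := ht
      exact hS hs ht'.1 hst.ne hst.subset
    have h3 : (P.filter fun t => t.card = j + 1 ∧ ∃ s ∈ S, s ⊂ t) ∪
        (S.filter fun s => s.card = j + 1) ⊆
        P.filter fun t => t.card = j + 1 ∧ ∃ s ∈ S, s ⊆ t := by
      refine Finset.union_subset (fun t ht => ?_) fun t ht => ?_
      · simp only [Finset.mem_filter] at ht ⊢
        exact ⟨ht.1, ht.2.1, ht.2.2.imp fun s hs => ⟨hs.1, hs.2.subset⟩⟩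
      · simp only [Finset.mem_filter] at ht ⊢
        exact ⟨hSP ht.1, ht.2, t, ht.1, subset_rfl⟩
    have h4 : (S.filter fun s => s.card ≤ j + 1) ⊆
        (S.filter fun s => s.card ≤ j) ∪ S.filter fun s => s.card = j + 1 := fun s hs => by
      simp only [Finset.mem_filter, Finset.mem_union] at hs ⊢
      have := hs.1
      have := hs.2
      grind
    have h5 := (Finset.card_le_card h4).trans (Finset.card_union_le _ _)
    have h6 := Finset.card_le_card h3
    rw [Finset.card_union_of_disjoint hdisj] at h6
    omega

/-- A matching gives a fractional matching. -/
lemma isLevelFlow_of_matching {P : Finset (Finset α)} {m : ℕ} (M : Finset α → Finset α)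
    (hM : ∀ a ∈ P, a.card = m → M a ∈ P ∧ a ⊂ M a ∧ (M a).card = m + 1)
    (hinj : ∀ a ∈ P, a.card = m → ∀ a' ∈ P, a'.card = m → M a = M a' → a = a') :
    IsLevelFlow P m fun s x =>
      if s ∈ P ∧ s.card = m ∧ x ∉ s ∧ insert x s = M s then 1 else 0 := by
  refine ⟨fun s x => by split_ifs <;> norm_num, fun s x h => ?_, fun s x h => ?_,
    fun s hs hm => ?_, fun t ht hm => ?_⟩
  · exact (ite_ne_right_iff.1 h).1.2.2.1
  · obtain ⟨h1, h2, -, h3⟩ := (ite_ne_right_iff.1 h).1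
    exact h3 ▸ (hM s h1 h2).1
  · obtain ⟨-, h2, h3⟩ := hM s hs hm
    obtain ⟨x, hx, hxM⟩ := Finset.exists_eq_insert_iff.2 ⟨h2.subset, hm.symm ▸ h3.symm⟩
    rw [Finset.sum_eq_single x]
    · simp [hs, hm, hx, hxM]
    · intro y _ hyx
      refine if_neg fun h => hyx ?_
      have : y ∈ insert x s := by rw [hxM, ← h.2.2.2]; exact Finset.mem_insert_self _ _
      exact (Finset.mem_insert.1 this).resolve_right h.2.2.1
    · simp
  · rw [Finset.sum_ite, Finset.sum_const_zero, add_zero, Finset.sum_const, nsmul_eq_mul, mul_one]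
    norm_cast
    refine Finset.card_le_one.2 fun x hx y hy => ?_
    simp only [Finset.mem_filter] at hx hy
    obtain ⟨hxt, hx1, hx2, -, hx4⟩ := hx
    obtain ⟨hyt, hy1, hy2, -, hy4⟩ := hy
    rw [Finset.insert_erase hxt] at hx4
    rw [Finset.insert_erase hyt] at hy4
    exact Finset.erase_injOn _ hxt hyt (hinj _ hx1 hx2 _ hy1 hy2 (hx4.symm.trans hy4))

/-- Let `A` be the shadow of a family `B` of sets of size `m + 1`, matched into `B` with `Y ∈ B`
missed. Then every antichain `T` with an element properly below `Y` can be pushed up into `B` to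
give a larger antichain. -/
lemma exists_isAntichain_card_lt {A B T : Finset (Finset α)} {Y : Finset α} {m : ℕ}
    (hB : ∀ b ∈ B, b.card = m + 1) (hY : Y ∈ B)
    (hface : ∀ b ∈ B, ∀ x ∈ b, b.erase x ∈ A)
    (M : Finset α → Finset α) (hM : ∀ a ∈ A, M a ∈ B ∧ a ⊂ M a ∧ M a ≠ Y)
    (hinj : Set.InjOn M A) (hT : IsAntichain (· ≤ ·) (T : Set (Finset α)))
    (hTY : ∃ t ∈ T, t ⊂ Y) :
    ∃ T' ⊆ T ∪ B, IsAntichain (· ≤ ·) (T' : Set (Finset α)) ∧ T.card < T'.card := by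
  -- The downset generated by `B`: its level `m` lies in `A`, and every smaller set extends within
  -- it because all of `B` has size `m + 1`.
  set P : Finset (Finset α) := Finset.univ.filter fun s => ∃ b ∈ B, s ⊆ b with hPdef
  have memP : ∀ s, s ∈ P ↔ ∃ b ∈ B, s ⊆ b := fun s => by simp [hPdef]
  have hP : IsLowerSet (P : Set (Finset α)) := fun s t hts hs => by
    obtain ⟨b, hb, hsb⟩ := (memP s).1 hs
    exact (memP t).2 ⟨b, hb, le_trans hts hsb⟩
  have hPA : ∀ s ∈ P, s.card = m → s ∈ A := fun s hs hm => by
    obtain ⟨b, hb, hsb⟩ := (memP s).1 hs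
    obtain ⟨x, hx, rfl⟩ := Finset.exists_eq_insert_iff.2 ⟨hsb, hm.symm ▸ (hB b hb).symm⟩
    simpa [Finset.erase_insert hx] using hface _ hb x (Finset.mem_insert_self _ _)
  have hBP : ∀ b ∈ B, b ∈ P := fun b hb => (memP b).2 ⟨b, hb, subset_rfl⟩
  have hpure : ∀ s ∈ P, s.card ≤ m → ∃ y ∉ s, insert y s ∈ P := fun s hs hm => by
    obtain ⟨b, hb, hsb⟩ := (memP s).1 hs
    have hlt : s.card < b.card := by rw [hB b hb]; omega
    obtain ⟨y, hyb, hys⟩ := Finset.exists_mem_notMem_of_card_lt_card hlt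
    exact ⟨y, hys, (memP _).2 ⟨b, hb, Finset.insert_subset hyb hsb⟩⟩
  have hF := isLevelFlow_of_matching (P := P) (m := m) M
    (fun a ha hm => ⟨hBP _ (hM a (hPA a ha hm)).1, (hM a (hPA a ha hm)).2.1,
      hB _ (hM a (hPA a ha hm)).1⟩)
    (fun a ha hm a' ha' hm' h => hinj (hPA a ha hm) (hPA a' ha' hm') h)
  set S := T.filter fun t => t ∈ P ∧ t.card ≤ m with hSdef
  have hST : S ⊆ T := Finset.filter_subset _ _
  have hS : IsAntichain (· ≤ ·) (S : Set (Finset α)) := hT.subset (by exact_mod_cast hST)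
  have h1 := card_le_card_above_of_isLevelFlow hS (fun s hs => (Finset.mem_filter.1 hs).2.1) m
    fun j hj => hF.exists_of_le hP hpure hj.le
  have hSm : (S.filter fun s => s.card ≤ m) = S :=
    Finset.filter_true_of_mem fun s hs => (Finset.mem_filter.1 hs).2.2
  rw [hSm] at h1
  set U := P.filter fun t => t.card = m ∧ ∃ s ∈ S, s ⊆ t with hU
  set V := B.filter fun b => ∃ s ∈ S, s ⊂ b with hV
  have hUA : ∀ a ∈ U, a ∈ A := fun a ha =>
    hPA a (Finset.mem_filter.1 ha).1 (Finset.mem_filter.1 ha).2.1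
  -- `M` embeds `U` in `V` and misses `Y`, which belongs to `V` because of the member of `T` below
  -- it. This is where the antichain gains an element.
  have h2 : U.card + 1 ≤ V.card := by
    have hYM : Y ∉ U.image M := fun h => by
      obtain ⟨a, ha, h⟩ := Finset.mem_image.1 h
      exact (hM a (hUA a ha)).2.2 h
    rw [← Finset.card_image_of_injOn (hinj.mono hUA), ← Finset.card_insert_of_notMem hYM]
    refine Finset.card_le_card fun b hb => Finset.mem_filter.2 ?_
    rcases Finset.mem_insert.1 hb with rfl | hb
    · obtain ⟨t, ht, htY⟩ := hTY
      have := Finset.card_lt_card htY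
      rw [hB _ hY] at this
      exact ⟨hY, t, Finset.mem_filter.2 ⟨ht, (memP t).2 ⟨_, hY, htY.subset⟩, by omega⟩, htY⟩
    · obtain ⟨a, ha, rfl⟩ := Finset.mem_image.1 hb
      obtain ⟨s, hs, hsa⟩ := (Finset.mem_filter.1 ha).2.2
      exact ⟨(hM a (hUA a ha)).1, s, hs, hsa.trans_ssubset (hM a (hUA a ha)).2.1⟩
  have hVS : ∀ b ∈ V, b ∉ T := fun b hb hbT => by
    obtain ⟨s, hs, hsb⟩ := (Finset.mem_filter.1 hb).2
    exact hT (hST hs) hbT hsb.ne hsb.subset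
  refine ⟨(T \ S) ∪ V, ?_, ?_, ?_⟩
  · exact Finset.union_subset_union Finset.sdiff_subset (Finset.filter_subset _ _)
  · have hTV : ∀ t ∈ T \ S, ∀ b ∈ V, ¬ t ≤ b ∧ ¬ b ≤ t := fun t ht b hb => by
      obtain ⟨htT, htS⟩ := Finset.mem_sdiff.1 ht
      refine ⟨fun h => htS ?_, fun h => ?_⟩
      · have hbB := (Finset.mem_filter.1 hb).1
        have hne : t ≠ b := fun h => hVS b hb (h ▸ htT)
        have := Finset.card_lt_card (lt_of_le_of_ne h hne)
        rw [hB b hbB] at this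
        exact Finset.mem_filter.2 ⟨htT, (memP t).2 ⟨b, hbB, h⟩, by omega⟩
      · obtain ⟨s, hs, hsb⟩ := (Finset.mem_filter.1 hb).2
        have hst : s ⊂ t := lt_of_lt_of_le hsb h
        exact hT (hST hs) htT hst.ne hst.subset
    intro x hx y hy hxy
    rw [Finset.mem_coe, Finset.mem_union] at hx hy
    rcases hx with hx | hx <;> rcases hy with hy | hy
    · exact hT (Finset.sdiff_subset hx) (Finset.sdiff_subset hy) hxy
    · exact (hTV x hx y hy).1
    · exact (hTV y hy x hx).2
    · intro h
      have := Finset.card_lt_card (lt_of_le_of_ne h hxy)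
      rw [hB x (Finset.mem_filter.1 hx).1, hB y (Finset.mem_filter.1 hy).1] at this
      omega
  · have hd : Disjoint (T \ S) V := Finset.disjoint_right.2 fun b hb hbT =>
      hVS b hb (Finset.sdiff_subset hbT)
    rw [Finset.card_union_of_disjoint hd, Finset.card_sdiff_of_subset hST]
    have := Finset.card_le_card hST
    omega

end LevelFlow

/-! ### Width and chain colourings. -/

section Width

variable {α : Type*} [PartialOrder α]

lemma IsAntichain.card_le_width {X T : Finset α} (hT : IsAntichain (· ≤ ·) (T : Set α))
    (h : T ⊆ X) : T.card ≤ width X := by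
  classical
  rw [width]
  exact Finset.le_sup (f := Finset.card) (Finset.mem_filter.2 ⟨Finset.mem_powerset.2 h, hT⟩)

lemma exists_isAntichain_card_eq_width (X : Finset α) :
    ∃ T ⊆ X, IsAntichain (· ≤ ·) (T : Set α) ∧ T.card = width X := by
  classical
  obtain ⟨T, hT, h⟩ := Finset.exists_mem_eq_sup
    (X.powerset.filter fun A : Finset α => IsAntichain (· ≤ ·) (A : Set α))
    ⟨∅, by simp⟩ Finset.card
  rw [Finset.mem_filter, Finset.mem_powerset] at hT
  refine ⟨T, hT.1, hT.2, ?_⟩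
  rw [← h, width]

lemma width_mono {X X' : Finset α} (h : X ⊆ X') : width X ≤ width X' := by
  obtain ⟨T, hT, hT', h'⟩ := exists_isAntichain_card_eq_width X
  exact h' ▸ hT'.card_le_width (hT.trans h)

/-- A colouring of `X` in which elements of the same colour are comparable. -/
def IsChainColoring {ι : Type*} (X : Finset α) (col : α → ι) : Prop :=
  ∀ a ∈ X, ∀ b ∈ X, col a = col b → a ≤ b ∨ b ≤ a

lemma IsChainColoring.width_le {ι : Type*} {X : Finset α} {col : α → ι}
    (h : IsChainColoring X col) {I : Finset ι} (hI : ∀ a ∈ X, col a ∈ I) :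
    width X ≤ I.card := by
  obtain ⟨T, hT, hT', h'⟩ := exists_isAntichain_card_eq_width X
  rw [← h']
  refine Finset.card_le_card_of_injOn col (fun a ha => hI a (hT ha)) fun a ha b hb hab => ?_
  by_contra hne
  rcases h a (hT ha) b (hT hb) hab with hle | hle
  · exact hT' ha hb hne hle
  · exact hT' hb ha (Ne.symm hne) hle

end Width

/-! ### Augmenting a chain colouring. -/

/-- Switching chains along an augmenting sequence `Y = v 0, v 1, …, v (2 r + 1)` makes room for
`Y`. -/
lemma IsChainColoring.exists_insert {α ι : Type*} [DecidableEq α] {D : Finset (Finset α)}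
    {I : Finset ι} {k : ℕ} (v : ℕ → Finset α) (hv0 : v 0 ∉ D) (r : ℕ)
    (hinj : Set.InjOn v {i | i ≤ 2 * r + 1})
    (hmem : ∀ i, 1 ≤ i → i ≤ 2 * r + 1 → v i ∈ D)
    (heven : ∀ i ≤ r, (v (2 * i)).card = k) (hodd : ∀ i ≤ r, (v (2 * i + 1)).card + 1 = k)
    (hsub : ∀ i ≤ r, v (2 * i + 1) ⊂ v (2 * i))
    (col : Finset α → ι) (hcol : IsChainColoring D col) (hI : ∀ a ∈ D, col a ∈ I)
    (hmatch : ∀ i < r, v (2 * i + 1) ⊂ v (2 * i + 2) ∧ col (v (2 * i + 1)) = col (v (2 * i + 2)))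
    (hmax : ∀ z ∈ D, col z = col (v (2 * r + 1)) → z ≤ v (2 * r + 1)) :
    ∃ col' : Finset α → ι, IsChainColoring (insert (v 0) D) col' ∧
      ∀ a ∈ insert (v 0) D, col' a ∈ I := by
  classical
  induction r generalizing col with
  | zero =>
    have hne : ∀ a ∈ D, a ≠ v 0 := fun a ha h => hv0 (h ▸ ha)
    have h1 := hmem 1 le_rfl le_rfl
    have hs : v 1 ⊂ v 0 := hsub 0 le_rfl
    refine ⟨Function.update col (v 0) (col (v 1)), ?_, ?_⟩
    · intro a ha b hb hab
      rcases Finset.mem_insert.1 ha with rfl | ha <;> rcases Finset.mem_insert.1 hb with rfl | hb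
      · exact Or.inl le_rfl
      · rw [Function.update_self, Function.update_of_ne (hne b hb)] at hab
        exact Or.inr ((hmax b hb hab.symm).trans hs.le)
      · rw [Function.update_self, Function.update_of_ne (hne a ha)] at hab
        exact Or.inl ((hmax a ha hab).trans hs.le)
      · rw [Function.update_of_ne (hne a ha), Function.update_of_ne (hne b hb)] at hab
        exact hcol a ha b hb hab
    · intro a ha
      rcases Finset.mem_insert.1 ha with rfl | ha
      · simpa using hI _ h1
      · rw [Function.update_of_ne (hne a ha)]
        exact hI a ha
  | succ r ih =>
    set X := v (2 * r + 1) with hX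
    set Y := v (2 * r + 2) with hY
    set Z := v (2 * r + 3) with hZ
    have hXD : X ∈ D := hmem _ (by omega) (by omega)
    have hYD : Y ∈ D := hmem _ (by omega) (by omega)
    have hZD : Z ∈ D := hmem _ (by omega) (by omega)
    have hXY : X ⊂ Y := (hmatch r r.lt_succ_self).1
    have hXYc : col X = col Y := (hmatch r r.lt_succ_self).2
    have hZY : Z ⊂ Y := hsub (r + 1) le_rfl
    have hXk : X.card + 1 = k := hodd r (by omega)
    have hYk : Y.card = k := heven (r + 1) le_rfl
    have hZk : Z.card + 1 = k := hodd (r + 1) le_rfl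
    replace hmax : ∀ z ∈ D, col z = col Z → z ≤ Z := hmax
    have hYZc : col Y ≠ col Z := fun h => by
      have := Finset.card_le_card (hmax Y hYD h)
      omega
    -- The part of the chain of `Y` from `Y` upwards moves on top of `Z`, the maximum of its chain
    -- and a subset of `Y`. This leaves `X` as the maximum of its chain and shortens the path by two
    -- edges.
    let col' : Finset α → ι := fun z => if col z = col Y ∧ Y ≤ z then col Z else col z
    have hpos : ∀ z, col z = col Y → Y ≤ z → col' z = col Z := fun z h h' => if_pos ⟨h, h'⟩
    have hneg : ∀ z, ¬ (col z = col Y ∧ Y ≤ z) → col' z = col z := fun z h => if_neg h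
    have hsmall : ∀ z, z.card + 1 = k → col' z = col z := fun z hz => hneg z fun h => by
      have := Finset.card_le_card h.2
      omega
    refine ih (hinj.mono fun i hi => by simp only [Set.mem_ofPred_eq] at hi ⊢; omega)
      (fun i h1 h2 => hmem i h1 (by omega)) (fun i hi => heven i (by omega))
      (fun i hi => hodd i (by omega)) (fun i hi => hsub i (by omega)) col' ?_ ?_ ?_ ?_
    · have hcross : ∀ a ∈ D, ∀ b ∈ D, (col a = col Y ∧ Y ≤ a) → ¬ (col b = col Y ∧ Y ≤ b) →
          col' a = col' b → b ≤ a := fun a ha b hb h h' hab => by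
        rw [hpos a h.1 h.2, hneg b h'] at hab
        exact (hmax b hb hab.symm).trans (hZY.le.trans h.2)
      intro a ha b hb hab
      by_cases h : col a = col Y ∧ Y ≤ a <;> by_cases h' : col b = col Y ∧ Y ≤ b
      · exact hcol a ha b hb (h.1.trans h'.1.symm)
      · exact Or.inr (hcross a ha b hb h h' hab)
      · exact Or.inl (hcross b hb a ha h' h hab.symm)
      · rw [hneg a h, hneg b h'] at hab
        exact hcol a ha b hb hab
    · intro a ha
      by_cases h : col a = col Y ∧ Y ≤ a
      · rw [hpos a h.1 h.2]
        exact hI Z hZD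
      · rw [hneg a h]
        exact hI a ha
    · intro i hi
      refine ⟨(hmatch i (by omega)).1, ?_⟩
      -- Earlier matched pairs keep their colour: their lower ends are too small to contain `Y`, and
      -- their upper ends have the size of `Y` but differ from it.
      rw [hsmall _ (hodd i (by omega)), (hmatch i (by omega)).2, hneg]
      rintro ⟨-, hle⟩
      have hc : (v (2 * i + 2)).card = k := heven (i + 1) (by omega)
      have := hinj (x₁ := 2 * r + 2) (x₂ := 2 * i + 2) (by simp) (by simp; omega)
        (Finset.eq_of_subset_of_card_le hle (by rw [hc]; exact hYk.ge))
      omega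
    · intro z hz hzX
      rw [hsmall X hXk] at hzX
      by_cases h : col z = col Y ∧ Y ≤ z
      · rw [hpos z h.1 h.2, hXYc] at hzX
        exact absurd hzX.symm hYZc
      · rw [hneg z h] at hzX
        have hzY : z ≤ Y := (hcol z hz Y hYD (hzX.trans hXYc)).resolve_right
          fun h' => h ⟨hzX.trans hXYc, h'⟩
        have hne : z ≠ Y := fun h' => h ⟨h' ▸ rfl, h'.ge⟩
        refine (hcol z hz X hXD hzX).elim id fun hXz => ?_
        have := Finset.card_lt_card (lt_of_le_of_ne hzY hne)
        exact (Finset.eq_of_subset_of_card_le hXz (by omega)).ge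

/-! ### Alternating paths. -/

section Alternating

variable {α : Type*} [DecidableEq α] {X : Finset α} {C : Finpartition X} {G : SimpleGraph α}

lemma chainMatching_adj_iff {a b : α} (ha : a ∈ X) (hb : b ∈ X) :
    (chainMatching C G).Adj a b ↔ G.Adj a b ∧ C.part a = C.part b := by
  refine and_congr_right fun _ => ⟨?_, fun h => ?_⟩
  · rintro ⟨c, hc, hac, hbc⟩
    rw [C.part_eq_of_mem hc hac, C.part_eq_of_mem hc hbc]
  · exact ⟨C.part a, C.part_mem.2 ha, C.mem_part ha, h ▸ C.mem_part hb⟩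

/-- A path of odd length in which every second edge, starting with the second one, belongs to the
matching given by `C`. -/
def IsAlternatingPath (C : Finpartition X) {y z : α} (p : G.Walk y z) : Prop :=
  p.IsPath ∧ Odd p.length ∧ ∀ i : ℕ, 2 * i + 2 ≤ p.length →
    (chainMatching C G).Adj (p.getVert (2 * i + 1)) (p.getVert (2 * i + 2))

lemma isAlternatingPath_of_adj {y z : α} (h : G.Adj y z) :
    IsAlternatingPath C (SimpleGraph.Walk.cons h SimpleGraph.Walk.nil) := by
  refine ⟨by simp [h.ne], by simp, fun i hi => ?_⟩
  simp at hi

lemma IsAlternatingPath.take {y z : α} {p : G.Walk y z} (hp : IsAlternatingPath C p) {i : ℕ}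
    (hi : i ≤ p.length) (hodd : Odd i) : IsAlternatingPath C (p.take i) := by
  have hl : (p.take i).length = i := by rw [p.take_length, min_eq_left hi]
  refine ⟨hp.1.take i, hl.symm ▸ hodd, fun j hj => ?_⟩
  rw [hl] at hj
  rw [p.take_getVert, p.take_getVert, min_eq_right (by omega), min_eq_right hj]
  exact hp.2.2 j (hj.trans hi)

lemma IsAlternatingPath.concat_concat {y x b x' : α} {p : G.Walk y x}
    (hp : IsAlternatingPath C p) (hxb : (chainMatching C G).Adj x b) (hbx : G.Adj b x')
    (hb : b ∉ p.support) (hx' : x' ∉ p.support) :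
    IsAlternatingPath C ((p.concat hxb.1).concat hbx) := by
  have hlen : ((p.concat hxb.1).concat hbx).length = p.length + 2 := by
    simp [SimpleGraph.Walk.length_concat]
  have hget : ∀ i ≤ p.length, ((p.concat hxb.1).concat hbx).getVert i = p.getVert i := by
    intro i hi
    rw [SimpleGraph.Walk.concat, SimpleGraph.Walk.getVert_append',
      if_pos (by rw [SimpleGraph.Walk.length_concat]; omega), SimpleGraph.Walk.concat,
      SimpleGraph.Walk.getVert_append', if_pos hi]
  have hget' : ((p.concat hxb.1).concat hbx).getVert (p.length + 1) = b := by
    rw [SimpleGraph.Walk.concat, SimpleGraph.Walk.getVert_append',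
      if_pos (by rw [SimpleGraph.Walk.length_concat]),
      ← SimpleGraph.Walk.length_concat p hxb.1, SimpleGraph.Walk.getVert_length]
  refine ⟨(hp.1.concat hb hxb.1).concat ?_ hbx, ?_, fun i hi => ?_⟩
  · rw [SimpleGraph.Walk.support_concat]
    simp [hx', hbx.ne']
  · rw [hlen]
    exact hp.2.1.add_even even_two
  · rw [hlen] at hi
    obtain ⟨r, hr⟩ := hp.2.1
    rcases Nat.lt_or_ge i r with h | h
    · rw [hget _ (by omega), hget _ (by omega)]
      exact hp.2.2 i (by omega)
    · obtain rfl : i = r := by omega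
      rw [hget _ (by omega), show 2 * i + 2 = p.length + 1 by omega, hget', ← hr,
        SimpleGraph.Walk.getVert_length]
      exact hxb

end Alternating

/-! ### Walks in the level graph. -/

section LevelGraph

variable {n : ℕ} {F : Finset (Finset (Fin n))} {k : ℕ}

lemma levelGraph_adj_of_ssubset {A B : Finset (Fin n)} (hA : A ∈ F) (hB : B ∈ F)
    (hk : B.card = k) (hAk : A.card + 1 = k) (h : A ⊂ B) : (levelGraph F k).Adj B A :=
  ⟨hB, hA, Or.inr ⟨hAk, hk, h⟩⟩

lemma levelGraph_adj_of_card_eq {A B : Finset (Fin n)} (h : (levelGraph F k).Adj A B)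
    (hA : A.card = k) : B.card + 1 = k ∧ B ⊂ A := by
  rcases h.2.2 with h' | h'
  · omega
  · exact ⟨h'.1, h'.2.2⟩

lemma levelGraph_adj_of_card_add_one_eq {A B : Finset (Fin n)} (h : (levelGraph F k).Adj A B)
    (hA : A.card + 1 = k) : B.card = k ∧ A ⊂ B := by
  rcases h.2.2 with h' | h'
  · exact ⟨h'.2.1, h'.2.2⟩
  · omega

lemma levelGraph_card_getVert {Y Z : Finset (Fin n)} (hY : Y.card = k)
    (p : (levelGraph F k).Walk Y Z) (i : ℕ) :
    (2 * i ≤ p.length → (p.getVert (2 * i)).card = k) ∧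
      (2 * i + 1 ≤ p.length → (p.getVert (2 * i + 1)).card + 1 = k) := by
  induction i with
  | zero =>
    refine ⟨fun _ => by simpa using hY, fun h => ?_⟩
    have := p.adj_getVert_succ (i := 0) (by omega)
    rw [p.getVert_zero] at this
    exact (levelGraph_adj_of_card_eq this hY).1
  | succ i ih =>
    have h1 : 2 * (i + 1) ≤ p.length → (p.getVert (2 * (i + 1))).card = k := fun h =>
      (levelGraph_adj_of_card_add_one_eq (p.adj_getVert_succ (i := 2 * i + 1) (by omega))
        (ih.2 (by omega))).1
    exact ⟨h1, fun h =>
      (levelGraph_adj_of_card_eq (p.adj_getVert_succ (i := 2 * (i + 1)) (by omega))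
        (h1 (by omega))).1⟩

lemma levelGraph_card_of_isAlternatingPath {D : Finset (Finset (Fin n))} {C : Finpartition D}
    {Y Z : Finset (Fin n)} (hY : Y.card = k) {p : (levelGraph F k).Walk Y Z}
    (hp : IsAlternatingPath C p) : Z.card + 1 = k := by
  obtain ⟨r, hr⟩ := hp.2.1
  have := (levelGraph_card_getVert hY p r).2 hr.ge
  rwa [← hr, p.getVert_length] at this

end LevelGraph

/-! ### The two implications. -/

section Augmenting

variable {n : ℕ} {D : Finset (Finset (Fin n))} {C : Finpartition D} {k : ℕ} {Y : Finset (Fin n)}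

lemma isChainColoring_part (hC : IsSDPartition C) : IsChainColoring D C.part := by
  intro a ha b hb hab
  exact (hC.1 _ (C.part_mem.2 ha)).2.1.total (C.mem_part ha) (hab ▸ C.mem_part hb)

/-- The chains of `C` serve as colours. Switching introduces no new colour, and only comparability
within a colour is needed to bound the width. -/
lemma width_insert_le_of_isAugmentingPath (hC : IsSDPartition C) (hY : Y ∉ D) (hk : Y.card = k)
    {Z : Finset (Fin n)} {p : (levelGraph (insert Y D) k).Walk Y Z}
    (hp : IsAugmentingPath C p) : width (insert Y D) ≤ width D := by
  obtain ⟨hpath, ⟨r, hr⟩, hmatch, c, hc, hZ⟩ := hp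
  have hcard := levelGraph_card_getVert hk p
  have hmem : ∀ i, 1 ≤ i → i ≤ 2 * r + 1 → p.getVert i ∈ D := by
    intro i h1 hi
    obtain ⟨j, rfl⟩ : ∃ j, i = j + 1 := ⟨i - 1, by omega⟩
    refine (Finset.mem_insert.1 (p.adj_getVert_succ (i := j) (by omega)).2.1).resolve_left ?_
    intro h
    have := (hpath.getVert_eq_start_iff (i := j + 1) (by omega)).1 h
    omega
  have hinj := hpath.getVert_injOn
  rw [hr] at hinj
  have hlast : p.getVert (2 * r + 1) = Z := hr ▸ p.getVert_length
  obtain ⟨col, hcol, hI⟩ := IsChainColoring.exists_insert (D := D) (I := C.parts) (k := k)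
    p.getVert (by rwa [p.getVert_zero]) r hinj hmem (fun i hi => (hcard i).1 (by omega))
    (fun i hi => (hcard i).2 (by omega))
    (fun i hi => (levelGraph_adj_of_card_eq (p.adj_getVert_succ (by omega))
      ((hcard i).1 (by omega))).2)
    C.part (isChainColoring_part hC) (fun a ha => C.part_mem.2 ha)
    (fun i hi => ⟨(levelGraph_adj_of_card_add_one_eq (p.adj_getVert_succ (by omega))
      ((hcard i).2 (by omega))).2, ((chainMatching_adj_iff (hmem _ (by omega) (by omega))
        (hmem _ (by omega) (by omega))).1 (hmatch i (by omega))).2⟩)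
    (fun z hz h => by
      rw [hlast] at h ⊢
      refine hZ.2 ?_
      rw [C.part_eq_of_mem hc hZ.1] at h
      exact h ▸ C.mem_part hz)
  rw [p.getVert_zero] at hcol hI
  rw [← hC.2]
  exact hcol.width_le hI

/-- In a skipless chain partition of a downset, an element which is not the maximum of its chain
is matched with the next element of its chain. -/
lemma exists_chainMatching_adj (hD : IsLowerSet (D : Set (Finset (Fin n))))
    (hC : IsSDPartition C) {X : Finset (Fin n)} (hX : X ∈ D) (hXk : X.card + 1 = k)
    (hmax : ¬ ∃ c ∈ C.parts, IsGreatest (c : Set (Finset (Fin n))) X) :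
    ∃ B ∈ D, (chainMatching C (levelGraph (insert Y D) k)).Adj X B := by
  have hc : C.part X ∈ C.parts := C.part_mem.2 hX
  obtain ⟨hcD, hchain, hskip⟩ := hC.1 _ hc
  have hXc := C.mem_part hX
  obtain ⟨W, hW⟩ : ∃ W ∈ C.part X, X < W := by
    by_contra! h
    refine hmax ⟨_, hc, hXc, fun z hz => ?_⟩
    rcases hchain.total hXc hz with h' | h'
    · by_contra hne
      exact h z hz (lt_of_le_of_ne h' fun h => hne h.ge)
    · exact h'
  obtain ⟨B, hB, hBmin⟩ := ((C.part X).filter fun W => X < W).exists_min_image Finset.card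
    ⟨W, Finset.mem_filter.2 hW⟩
  rw [Finset.mem_filter] at hB
  have hcov : CoversIn (C.part X) X B := by
    refine ⟨hXc, hB.1, hB.2, fun z hz hXz hzB => ?_⟩
    rcases eq_or_lt_of_le hXz with h | h
    · exact Or.inl h.symm
    · exact Or.inr (Finset.eq_of_subset_of_card_le hzB
        (hBmin z (Finset.mem_filter.2 ⟨hz, h⟩)))
  obtain ⟨-, hBD, -, hcov'⟩ := hskip _ _ hcov
  obtain ⟨y, hyB, hyX⟩ := Finset.exists_of_ssubset hB.2
  -- The downset contains `insert y X`, which lies between `X` and its cover `B`, so it equals `B`;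
  -- hence `B` has size `k`.
  have hle : insert y X ≤ B := Finset.insert_subset hyB hB.2.le
  have hBk : B.card = k := by
    rcases hcov' _ (hD hle hBD) (Finset.subset_insert _ _) hle with h | h
    · exact absurd (h ▸ Finset.mem_insert_self y X) hyX
    · rw [← h, Finset.card_insert_of_notMem hyX, hXk]
  exact ⟨B, hBD, (levelGraph_adj_of_ssubset (Finset.mem_insert_of_mem hX)
    (Finset.mem_insert_of_mem hBD) hBk hXk hB.2).symm, _, hc, hXc, hB.1⟩

/-- Two sets matched to `B` lie in one chain, where equal size forces equality. -/
lemma chainMatching_left_unique {F : Finset (Finset (Fin n))} (hC : IsSDPartition C)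
    {X X' B : Finset (Fin n)} (hX : X ∈ D) (hX' : X' ∈ D) (hB : B ∈ D)
    (h : (chainMatching C (levelGraph F k)).Adj X B)
    (h' : (chainMatching C (levelGraph F k)).Adj X' B) (hcard : X.card = X'.card) : X = X' := by
  have e := ((chainMatching_adj_iff hX hB).1 h).2.trans ((chainMatching_adj_iff hX' hB).1 h').2.symm
  rcases isChainColoring_part hC X hX X' hX' e with hle | hle
  · exact Finset.eq_of_subset_of_card_le hle hcard.ge
  · exact (Finset.eq_of_subset_of_card_le hle hcard.le).symm

/-- The end `X` of an alternating path, together with its partner `B`, yields alternating paths to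
all neighbours of `B`. -/
lemma IsAlternatingPath.exists_extend (hC : IsSDPartition C) (hY : Y ∉ D) (hk : Y.card = k)
    {X B X' : Finset (Fin n)} {p : (levelGraph (insert Y D) k).Walk Y X}
    (hp : IsAlternatingPath C p) (hX : X ∈ D) (hB : B ∈ D)
    (hXB : (chainMatching C (levelGraph (insert Y D) k)).Adj X B)
    (hBX : (levelGraph (insert Y D) k).Adj B X') :
    ∃ q : (levelGraph (insert Y D) k).Walk Y X', IsAlternatingPath C q := by
  have hcard := levelGraph_card_getVert hk p
  have hXk := levelGraph_card_of_isAlternatingPath hk hp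
  have hBk := (levelGraph_adj_of_card_add_one_eq hXB.1 hXk).1
  have hX'k := (levelGraph_adj_of_card_eq hBX hBk).1
  by_cases hX's : X' ∈ p.support
  · obtain ⟨i, rfl, hi⟩ := SimpleGraph.Walk.mem_support_iff_exists_getVert.1 hX's
    -- If the path already visits `X'`, cut it there; the size `k - 1` of `X'` makes its position
    -- odd.
    refine ⟨p.take i, hp.take hi ?_⟩
    by_contra heven
    obtain ⟨j, rfl⟩ := even_iff_two_dvd.1 (Nat.not_odd_iff_even.1 heven)
    have := (hcard j).1 hi
    omega
  · refine ⟨_, hp.concat_concat hXB hBX (fun hBs => ?_) hX's⟩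
    obtain ⟨i, rfl, hi⟩ := SimpleGraph.Walk.mem_support_iff_exists_getVert.1 hBs
    rcases Nat.even_or_odd' i with ⟨j, rfl | rfl⟩
    · rcases j with _ | j
      · exact hY (by simpa using hB)
      -- Were `B` already on the path, its predecessor there would be matched to it and so equal
      -- `X`, which occurs only at the end.
      · have h1 := hp.2.2 j hi
        have h2 := (hcard j).2 (by omega)
        have hmem : p.getVert (2 * j + 1) ∈ D := by
          obtain ⟨c, hc, h, -⟩ := h1.2
          exact C.le hc h
        have h3 := chainMatching_left_unique hC hmem hX hB h1 hXB (by omega)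
        have := (hp.1.getVert_eq_end_iff (i := 2 * j + 1) (by omega)).1 h3
        omega
    · have := (hcard j).2 hi
      omega

lemma exists_isAugmentingPath_of_width_eq (hD : IsLowerSet (D : Set (Finset (Fin n))))
    (hC : IsSDPartition C) (hY : Y ∉ D) (hk : Y.card = k)
    (hD' : IsLowerSet ((insert Y D : Finset (Finset (Fin n))) : Set (Finset (Fin n))))
    (hw : width D = width (insert Y D)) :
    ∃ (Z : Finset (Fin n)) (p : (levelGraph (insert Y D) k).Walk Y Z), IsAugmentingPath C p := by
  classical
  by_contra! hno
  obtain ⟨T, hTD, hT, hTw⟩ := exists_isAntichain_card_eq_width D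
  suffices h : ∃ T' ⊆ insert Y D, IsAntichain (· ≤ ·) (T' : Set (Finset (Fin n))) ∧
      T.card < T'.card by
    obtain ⟨T', hT'D, hT', hlt⟩ := h
    have := hT'.card_le_width hT'D
    omega
  have hYne : ∀ t ∈ D, t ≠ Y := fun t ht h => hY (h ▸ ht)
  by_cases hTY : ∃ t ∈ T, t ⊂ Y
  · set A : Finset (Finset (Fin n)) := D.filter fun X =>
      ∃ p : (levelGraph (insert Y D) k).Walk Y X, IsAlternatingPath C p with hAdef
    have hAD : ∀ a ∈ A, a ∈ D := fun a ha => (Finset.mem_filter.1 ha).1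
    have hAk : ∀ a ∈ A, a.card + 1 = k := fun a ha => by
      obtain ⟨p, hp⟩ := (Finset.mem_filter.1 ha).2
      exact levelGraph_card_of_isAlternatingPath hk hp
    have hM : ∀ a ∈ A, ∃ B ∈ D, (chainMatching C (levelGraph (insert Y D) k)).Adj a B :=
      fun a ha => by
        obtain ⟨p, hp⟩ := (Finset.mem_filter.1 ha).2
        exact exists_chainMatching_adj hD hC (hAD a ha) (hAk a ha)
          fun h => hno a p ⟨hp.1, hp.2.1, hp.2.2, h⟩
    choose! M hMD hM using hM
    have hMk : ∀ a ∈ A, (M a).card = k ∧ a ⊂ M a := fun a ha =>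
      levelGraph_adj_of_card_add_one_eq (hM a ha).1 (hAk a ha)
    -- A proper subset of `Y` exists, so `k` is positive and the truncated subtraction is harmless.
    have hkpos : k - 1 + 1 = k := by
      obtain ⟨t, -, ht⟩ := hTY
      have := Finset.card_lt_card ht
      omega
    have herase : ∀ b ∈ insert Y D, b.card = k → ∀ x ∈ b, b.erase x ∈ D ∧
        (levelGraph (insert Y D) k).Adj b (b.erase x) := fun b hb hbk x hx => by
      have hmem : b.erase x ∈ insert Y D := hD' (Finset.erase_subset x b) hb
      have hc := Finset.card_erase_add_one hx
      refine ⟨(Finset.mem_insert.1 hmem).resolve_left fun h => ?_,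
        levelGraph_adj_of_ssubset hmem hb hbk (by omega) (Finset.erase_ssubset hx)⟩
      rw [h] at hc
      omega
    obtain ⟨T', hT', h⟩ := exists_isAntichain_card_lt (A := A) (B := insert Y (A.image M))
      (Y := Y) (m := k - 1)
      (fun b hb => by
        rw [hkpos]
        rcases Finset.mem_insert.1 hb with rfl | hb
        · exact hk
        · obtain ⟨a, ha, rfl⟩ := Finset.mem_image.1 hb
          exact (hMk a ha).1)
      (Finset.mem_insert_self _ _)
      (fun b hb x hx => by
        rcases Finset.mem_insert.1 hb with rfl | hb
        · obtain ⟨h1, h2⟩ := herase b (Finset.mem_insert_self _ _) hk x hx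
          exact Finset.mem_filter.2 ⟨h1, _, isAlternatingPath_of_adj h2⟩
        · obtain ⟨a, ha, rfl⟩ := Finset.mem_image.1 hb
          obtain ⟨h1, h2⟩ := herase (M a) (Finset.mem_insert_of_mem (hMD a ha)) (hMk a ha).1 x hx
          obtain ⟨p, hp⟩ := (Finset.mem_filter.1 ha).2
          exact Finset.mem_filter.2 ⟨h1, hp.exists_extend hC hY hk (hAD a ha) (hMD a ha)
            (hM a ha) h2⟩)
      M
      (fun a ha => ⟨Finset.mem_insert_of_mem (Finset.mem_image_of_mem M ha), (hMk a ha).2,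
        hYne _ (hMD a ha)⟩)
      (fun a ha a' ha' h => chainMatching_left_unique hC (hAD a ha) (hAD a' ha') (hMD a ha)
        (hM a ha) (h ▸ hM a' ha') (by have := hAk a ha; have := hAk a' ha'; omega))
      hT hTY
    refine ⟨T', hT'.trans (Finset.union_subset (hTD.trans (Finset.subset_insert _ _))
      (Finset.insert_subset_insert _ fun b hb => ?_)), h⟩
    obtain ⟨a, ha, rfl⟩ := Finset.mem_image.1 hb
    exact hMD a ha
  · refine ⟨insert Y T, Finset.insert_subset_insert _ hTD, ?_, ?_⟩
    · rw [Finset.coe_insert]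
      refine hT.insert (fun t ht _ h => hTY ⟨t, ht, lt_of_le_of_ne h (hYne t (hTD ht))⟩)
        fun t ht _ h => hY (hD h (hTD ht))
    · rw [Finset.card_insert_of_notMem fun h => hY (hTD h)]
      exact Nat.lt_succ_self _

end Augmenting

theorem proposition11 {n : ℕ} (D : Finset (Finset (Fin n)))
    (hD : IsLowerSet (D : Set (Finset (Fin n))))
    (C : Finpartition D) (hC : IsSDPartition C)
    (k : ℕ) (Y : Finset (Fin n)) (hY : Y ∉ D) (hk : Y.card = k)
    (hD' : IsLowerSet ((insert Y D : Finset (Finset (Fin n))) : Set (Finset (Fin n)))) :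
    width D = width (insert Y D) ↔
      ∃ (Z : Finset (Fin n)) (p : (levelGraph (insert Y D) k).Walk Y Z),
        IsAugmentingPath C p :=
  ⟨exists_isAugmentingPath_of_width_eq hD hC hY hk hD', fun ⟨_, _, hp⟩ =>
    (width_mono (Finset.subset_insert _ _)).antisymm
      (width_insert_le_of_isAugmentingPath hC hY hk hp)⟩
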